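/- Let $F$ be a differential field of characteristic zero, with derivation $D_F$, whose field of constants $C$ is algebraically closed. Let $E$ be a Picard–Vessiot closure of $F$: a differential field extension of $F$ whose constants are exactly those of $F$, in which every monic homogeneous linear differential equation $y^{(n)}+a_{n-1}y^{(n-1)}+\dots+a_0y=0$ over $F$ has $n$ solutions linearly independent over $C$, and which is generated as a field over $F$ by the solutions of all such equations. Let $R\subseteq E$ be its Picard–Vessiot ring, that is, the ring of all elements of $E$ which satisfy some monic homogeneous linear differential equation over $F$, and let $\Pi$ be the differential Galois group of $E$ over $F$, that is, the group of $F$-automorphisms of $E$ which commute with the derivation. A differential $F$-module is an $F$-vector space $V$ with an additive map $D\colon V\to V$ such that $D(av)=D_F(a)v+aD(v)$ for $a\in F$, $v\in V$; a vector $v\in V$ is cyclic if $V=\{D^nv+a_{n-1}D^{n-1}v+\dots+a_0v \mid n\ge 0,\ a_0,\dots,a_{n-1}\in F\}$. Let $\mathrm{Hom}_F^{\mathrm{diff}}(V,R)$ be the $C$-vector space of $F$-linear maps $V\to R$ commuting with the derivations, with the action $(\sigma f)(v)=\sigma(f(v))$ of $\Pi$, and for $v\in V$ let $\hat v\colon \mathrm{Hom}_F^{\mathrm{diff}}(V,R)\to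 R$ be the $\Pi$-module homomorphism ($C$-linear and $\Pi$-equivariant map) $f\mapsto f(v)$. Theorem (relative cyclic vector theorem). Let $V$ be a finite-dimensional differential $F$-module. If $\phi\colon \mathrm{Hom}_F^{\mathrm{diff}}(V,R)\to R$ is an injective homomorphism of $\Pi$-modules and $v\in V$ is such that $\hat v=\phi$, then $v$ is a cyclic vector for $V$. Conversely, if $v\in V$ is a cyclic vector, then $\hat v\colon \mathrm{Hom}_F^{\mathrm{diff}}(V,R)\to R$ is an injective homomorphism of $\Pi$-modules. -/

import Mathlib

open scoped Differential

namespace CyclicVector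

/-- The subfield of constants of a differential field. -/
def constants (F : Type*) [Field F] [Differential F] : Subfield F where
  carrier := {c | c′ = 0}
  zero_mem' := by simp
  one_mem' := by simp
  add_mem' {a b} ha hb := by
    simp only [Set.mem_ofPred_eq] at ha hb ⊢
    rw [map_add, ha, hb, add_zero]
  neg_mem' {a} ha := by
    simp only [Set.mem_ofPred_eq] at ha ⊢
    rw [map_neg, ha, neg_zero]
  mul_mem' {a b} ha hb := by
    simp only [Set.mem_ofPred_eq] at ha hb ⊢
    simp [ha, hb]
  inv_mem' a ha := by
    simp only [Set.mem_ofPred_eq] at ha ⊢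
    rw [Derivation.leibniz_inv, ha, smul_zero]

/-- A differential `F`-module: an `F`-vector space with an additive endomorphism `D`
satisfying the Leibniz rule over the derivation of `F`. -/
class DifferentialModule (F V : Type*) [Field F] [Differential F] [AddCommGroup V]
    [Module F V] where
  /-- The derivation of the module. -/
  D : V →+ V
  D_smul : ∀ (a : F) (v : V), D (a • v) = a′ • v + a • D v

open DifferentialModule (D D_smul)

/-- A commutative differential `F`-algebra is a differential `F`-module. -/
instance (F A : Type*) [Field F] [Differential F] [CommRing A] [Differential A] [Algebra F A]
    [DifferentialAlgebra F A] : DifferentialModule F A where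
  D := (Differential.deriv (R := A)).toLinearMap.toAddMonoidHom
  D_smul a v := by
    change (a • v)′ = (a′ • v + a • v′)
    simp [Algebra.smul_def, deriv_algebraMap, mul_comm]

section Modules

variable (F : Type*) {V : Type*} [Field F] [Differential F] [AddCommGroup V] [Module F V]
  [DifferentialModule F V]

variable {F} in
/-- The value at `v` of the monic linear differential operator of order `n` with
coefficients `a`: `Dⁿ v + aₙ₋₁ Dⁿ⁻¹ v + ⋯ + a₀ v`. -/
def monicOp {n : ℕ} (a : Fin n → F) (v : V) : V :=
  (D F)^[n] v + ∑ i : Fin n, a i • (D F)^[(i : ℕ)] v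

/-- `v` is a cyclic vector: every element of `V` is of the form
`Dⁿ v + aₙ₋₁ Dⁿ⁻¹ v + ⋯ + a₀ v` for some `n ≥ 0` and some `aᵢ` in `F`. -/
def IsCyclicVector (v : V) : Prop :=
  {w : V | ∃ (n : ℕ) (a : Fin n → F), w = monicOp a v} = Set.univ

/-- `v` satisfies a monic homogeneous linear differential equation over `F`. -/
def SatisfiesLinearODE (v : V) : Prop :=
  ∃ (n : ℕ) (a : Fin n → F), monicOp a v = 0

/-- An element satisfies a monic linear differential equation iff it lies in a
finite-dimensional `D`-stable subspace. -/
theorem satisfiesLinearODE_iff (v : V) :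
    SatisfiesLinearODE F v ↔
      ∃ M : Submodule F V, M.FG ∧ (∀ w ∈ M, D F w ∈ M) ∧ v ∈ M := by
  constructor
  · rintro ⟨n, a, h⟩
    have hmem : ∀ i : Fin n, (D F)^[(i : ℕ)] v ∈
        Submodule.span F (Set.range fun i : Fin n => (D F)^[(i : ℕ)] v) :=
      fun i => Submodule.subset_span ⟨i, rfl⟩
    have hn : (D F)^[n] v ∈
        Submodule.span F (Set.range fun i : Fin n => (D F)^[(i : ℕ)] v) := by
      rw [eq_neg_of_add_eq_zero_left h]
      exact Submodule.neg_mem _ (Submodule.sum_mem _ fun i _ => Submodule.smul_mem _ _ (hmem i))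
    have hle : ∀ i ≤ n, (D F)^[i] v ∈
        Submodule.span F (Set.range fun i : Fin n => (D F)^[(i : ℕ)] v) := by
      intro i hi
      rcases hi.lt_or_eq with hi | rfl
      · exact hmem ⟨i, hi⟩
      · exact hn
    refine ⟨Submodule.span F (Set.range fun i : Fin n => (D F)^[(i : ℕ)] v),
      Submodule.fg_span (Set.finite_range _), ?_, hle 0 (Nat.zero_le n)⟩
    intro w hw
    induction hw using Submodule.span_induction with
    | mem x hx =>
      obtain ⟨i, rfl⟩ := hx
      have := hle (i + 1) i.2
      rwa [Function.iterate_succ_apply'] at this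
    | zero => simp
    | add x y _ _ hx hy => rw [map_add]; exact Submodule.add_mem _ hx hy
    | smul b x hx' hx =>
      rw [D_smul]
      exact Submodule.add_mem _ (Submodule.smul_mem _ _ hx') (Submodule.smul_mem _ _ hx)
  · rintro ⟨M, hfg, hD, hv⟩
    have hit : ∀ i, (D F)^[i] v ∈ M := by
      intro i
      induction i with
      | zero => exact hv
      | succ i ih => rw [Function.iterate_succ_apply']; exact hD _ ih
    have : Module.Finite F M := Module.Finite.iff_fg.mpr hfg
    let f : ℕ →o Submodule F M :=
      { toFun := fun n => Submodule.span F
          (Set.range fun i : Fin n => (⟨(D F)^[(i : ℕ)] v, hit i⟩ : M))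
        monotone' := by
          intro m n hmn
          apply Submodule.span_mono
          rintro _ ⟨i, rfl⟩
          exact ⟨⟨i, i.2.trans_le hmn⟩, rfl⟩ }
    obtain ⟨n, hn⟩ := monotone_stabilizes_iff_noetherian.mpr
      (inferInstance : IsNoetherian F M) f
    have h1 : (⟨(D F)^[n] v, hit n⟩ : M) ∈ f n := by
      rw [hn (n + 1) n.le_succ]
      exact Submodule.subset_span ⟨Fin.last n, rfl⟩
    obtain ⟨c, hc⟩ := (Submodule.mem_span_range_iff_exists_fun F).mp h1
    refine ⟨n, fun i => -c i, ?_⟩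
    have hc' := congrArg (Submodule.subtype M) hc
    simp only [map_sum, map_smul, Submodule.subtype_apply] at hc'
    simp [monicOp, ← hc']

variable (V) in
/-- `Hom_F^diff(V, W)`: the `F`-linear maps commuting with the derivations, as a vector space
over the constants of `F`. -/
def diffHom (W : Type*) [AddCommGroup W] [Module F W] [DifferentialModule F W] :
    Submodule (constants F) (V →ₗ[F] W) where
  carrier := {f | ∀ v, f (D F v) = D F (f v)}
  zero_mem' := by simp
  add_mem' {f g} hf hg v := by simp [hf v, hg v]
  smul_mem' c f hf v := by
    have hc : (c : F)′ = 0 := c.2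
    change (c : F) • f (D F v) = D F ((c : F) • f v)
    rw [D_smul, hc, zero_smul, zero_add, hf v]

end Modules

section PicardVessiot

variable (F E : Type*) [Field F] [Differential F] [Field E] [Differential E] [Algebra F E]
  [DifferentialAlgebra F E]

/-- `E` is a Picard–Vessiot closure of `F`: a differential field extension without new constants
in which every monic homogeneous linear differential equation over `F`, of any order `n`, has a
full set of solutions (`n` solutions linearly independent over the constants), and which is
generated as a field over `F` by the solutions of all such equations. -/
structure IsPicardVessiotClosure : Prop where
  constants_le : ∀ x : E, x′ = 0 → ∃ c ∈ constants F, algebraMap F E c = x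
  full_solutions : ∀ (n : ℕ) (a : Fin n → F),
    ∃ y : Fin n → E, LinearIndependent (constants F) y ∧ ∀ i, monicOp a (y i) = 0
  generated : IntermediateField.adjoin F {y : E | SatisfiesLinearODE F y} = ⊤

/-- The Picard–Vessiot ring: the elements of `E` which satisfy a monic homogeneous linear
differential equation over `F`. -/
def picardVessiotRing : Subalgebra F E where
  carrier := {y | SatisfiesLinearODE F y}
  algebraMap_mem' r := by
    refine (satisfiesLinearODE_iff F _).mpr
      ⟨Submodule.span F {1}, Submodule.fg_span (Set.finite_singleton _), ?_, ?_⟩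
    · intro w hw
      obtain ⟨a, rfl⟩ := Submodule.mem_span_singleton.mp hw
      refine Submodule.mem_span_singleton.mpr ⟨a′, ?_⟩
      change _ = ((a • (1 : E))′)
      simp [Algebra.smul_def, deriv_algebraMap]
    · exact Submodule.mem_span_singleton.mpr ⟨r, by simp [Algebra.smul_def]⟩
  add_mem' {x y} hx hy := by
    obtain ⟨M, hM, hDM, hxM⟩ := (satisfiesLinearODE_iff F _).mp hx
    obtain ⟨N, hN, hDN, hyN⟩ := (satisfiesLinearODE_iff F _).mp hy
    refine (satisfiesLinearODE_iff F _).mpr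
      ⟨M ⊔ N, hM.sup hN, ?_, Submodule.add_mem_sup hxM hyN⟩
    intro w hw
    obtain ⟨m, hm, n, hn, rfl⟩ := Submodule.mem_sup.mp hw
    rw [map_add]
    exact Submodule.add_mem_sup (hDM m hm) (hDN n hn)
  mul_mem' {x y} hx hy := by
    obtain ⟨M, hM, hDM, hxM⟩ := (satisfiesLinearODE_iff F _).mp hx
    obtain ⟨N, hN, hDN, hyN⟩ := (satisfiesLinearODE_iff F _).mp hy
    refine (satisfiesLinearODE_iff F _).mpr
      ⟨M * N, hM.mul hN, ?_, Submodule.mul_mem_mul hxM hyN⟩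
    intro w hw
    induction hw using Submodule.mul_induction_on' with
    | mem_mul_mem m hm n hn =>
      have h : D F (m * n) = m * D F n + D F m * n := by
        change (m * n)′ = m * n′ + m′ * n
        simp [mul_comm]
      rw [h]
      exact Submodule.add_mem _ (Submodule.mul_mem_mul hm (hDN n hn))
        (Submodule.mul_mem_mul (hDM m hm) hn)
    | add a _ b _ ha hb => rw [map_add]; exact Submodule.add_mem _ ha hb

theorem deriv_mem_picardVessiotRing {y : E} (hy : y ∈ picardVessiotRing F E) :
    y′ ∈ picardVessiotRing F E := by
  obtain ⟨M, hM, hDM, hyM⟩ := (satisfiesLinearODE_iff F _).mp hy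
  exact (satisfiesLinearODE_iff F _).mpr ⟨M, hM, hDM, hDM y hyM⟩

/-- The Picard–Vessiot ring is a differential ring for the derivation of `E`. -/
instance : Differential (picardVessiotRing F E) where
  deriv := Derivation.mk'
    { toFun := fun y => ⟨(y : E)′, deriv_mem_picardVessiotRing F E y.2⟩
      map_add' := fun x y => Subtype.ext (by simp)
      map_smul' := fun m x => Subtype.ext (by simp) }
    (fun x y => Subtype.ext (by simp))

instance : DifferentialAlgebra F (picardVessiotRing F E) where
  deriv_algebraMap a := Subtype.ext (deriv_algebraMap (B := E) a)

/-- The differential Galois group of `E` over `F`: the `F`-automorphisms of `E` which commute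
with the derivation. -/
def differentialGaloisGroup : Subgroup (E ≃ₐ[F] E) where
  carrier := {σ | ∀ x, σ x′ = (σ x)′}
  one_mem' _ := rfl
  mul_mem' {σ τ} hσ hτ x := by
    change σ (τ x′) = ((σ (τ x))′)
    rw [hτ x, hσ (τ x)]
  inv_mem' {σ} hσ x := by
    apply σ.injective
    change σ (σ.symm x′) = σ ((σ.symm x)′)
    rw [hσ, σ.apply_symm_apply, σ.apply_symm_apply]

variable {F E} in
theorem apply_mem_picardVessiotRing (σ : differentialGaloisGroup F E) {y : E}
    (hy : y ∈ picardVessiotRing F E) : (σ : E ≃ₐ[F] E) y ∈ picardVessiotRing F E := by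
  obtain ⟨n, a, h⟩ := hy
  have hit : ∀ i, (σ : E ≃ₐ[F] E) ((D F)^[i] y) = (D F)^[i] ((σ : E ≃ₐ[F] E) y) := by
    intro i
    induction i with
    | zero => rfl
    | succ i ih =>
      rw [Function.iterate_succ_apply', Function.iterate_succ_apply', ← ih]
      exact σ.2 _
  refine ⟨n, a, ?_⟩
  have h' := congrArg (σ : E ≃ₐ[F] E) h
  simpa only [monicOp, map_add, map_sum, map_smul, map_zero, hit] using h'

variable {F E} in
/-- The restriction of a differential automorphism of `E` to the Picard–Vessiot ring. -/
def restrictRing (σ : differentialGaloisGroup F E) :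
    picardVessiotRing F E →ₗ[F] picardVessiotRing F E where
  toFun y := ⟨(σ : E ≃ₐ[F] E) y, apply_mem_picardVessiotRing σ y.2⟩
  map_add' x y := Subtype.ext (by simp)
  map_smul' a x := Subtype.ext (by simp)

/-- The Picard–Vessiot ring as a module over the differential Galois group. -/
def ringRep : Representation (constants F) (differentialGaloisGroup F E)
    (picardVessiotRing F E) where
  toFun σ := (restrictRing σ).restrictScalars (constants F)
  map_one' := rfl
  map_mul' _ _ := rfl

variable (V : Type*) [AddCommGroup V] [Module F V] [DifferentialModule F V]

/-- `Hom_F^diff(V, R)` as a module over the differential Galois group: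
`(σ · f)(v) = σ (f v)`. -/
def homRep : Representation (constants F) (differentialGaloisGroup F E)
    (diffHom F V (picardVessiotRing F E)) where
  toFun σ :=
    { toFun := fun f => ⟨restrictRing σ ∘ₗ f.1, fun v => by
        rw [LinearMap.comp_apply, LinearMap.comp_apply, f.2 v]
        exact Subtype.ext (σ.2 _)⟩
      map_add' := fun f g => Subtype.ext (LinearMap.comp_add _ _ _)
      map_smul' := fun c f => Subtype.ext (LinearMap.ext fun v =>
        (restrictRing σ).map_smul (c : F) (f.1 v)) }
  map_one' := rfl
  map_mul' _ _ := rfl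

variable {V} in
/-- The homomorphism `v̂ : Hom_F^diff(V, R) → R`, `f ↦ f v`, of modules over the differential
Galois group. -/
def hat (v : V) : (homRep F E V).IntertwiningMap (ringRep F E) where
  toFun f := f.1 v
  map_add' _ _ := rfl
  map_smul' _ _ := rfl
  isIntertwining' _ := rfl

end PicardVessiot

end CyclicVector

/-!
The second half of the theorem is immediate: a differential homomorphism that vanishes at `v`
vanishes at every `Dⁱ v`, and these span `V` when `v` is cyclic.

For the first half, let `W` be the span of all `Dⁱ v`, the smallest `D`-stable subspace
containing `v`. If `W` were proper, the nonzero differential module `V ⧸ W` would admit a nonzero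
differential homomorphism to the Picard–Vessiot ring `R` (`exists_diffHom_ne_zero`), and its
composite with the projection would be a nonzero element of the kernel of `v̂`. So `W = V`, and
then `v` is cyclic in the monic sense too (`isCyclicVector_iff_span`).

The existence of a nonzero homomorphism `V → R` for every nonzero `V` only needs nonzero solutions
of scalar equations. By induction on the dimension one may replace `V` by a nonzero proper
quotient, and thus assume that some nonzero `u` generates `V`. The iterates `u, …, Dⁿ⁻¹ u` then
form a basis for some `n ≥ 1`, and `u` satisfies a monic equation of order `n`. Any nonzero
solution `y` of that equation in `E` lies in `R`, and `Dⁱ u ↦ Dⁱ y` is the homomorphism.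
-/

namespace CyclicVector

open DifferentialModule (D D_smul)

/-! ### The differential submodule generated by a vector -/

section Span

variable (F : Type*) {V : Type*} [Field F] [Differential F] [AddCommGroup V] [Module F V]
  [DifferentialModule F V]

/-- The differential submodule generated by `v`: the span of the iterated derivatives of `v`. -/
def diffSpan (v : V) : Submodule F V :=
  Submodule.span F (Set.range fun i : ℕ => (D F)^[i] v)

variable {F}

theorem iterate_D_mem_diffSpan (v : V) (i : ℕ) : (D F)^[i] v ∈ diffSpan F v :=
  Submodule.subset_span ⟨i, rfl⟩

theorem self_mem_diffSpan (v : V) : v ∈ diffSpan F v :=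
  iterate_D_mem_diffSpan v 0

theorem D_mem_span_of_forall_mem {s : Set V} (hs : ∀ x ∈ s, D F x ∈ Submodule.span F s) {w : V}
    (hw : w ∈ Submodule.span F s) : D F w ∈ Submodule.span F s := by
  induction hw using Submodule.span_induction with
  | mem x hx => exact hs x hx
  | zero => simp
  | add x y _ _ hx hy => rw [map_add]; exact Submodule.add_mem _ hx hy
  | smul b x hx' hx =>
    rw [D_smul]
    exact Submodule.add_mem _ (Submodule.smul_mem _ _ hx') (Submodule.smul_mem _ _ hx)

theorem D_mem_diffSpan {v w : V} (hw : w ∈ diffSpan F v) : D F w ∈ diffSpan F v := by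
  refine D_mem_span_of_forall_mem ?_ hw
  rintro _ ⟨i, rfl⟩
  rw [← Function.iterate_succ_apply' (D F)]
  exact iterate_D_mem_diffSpan v (i + 1)

theorem monicOp_mem_diffSpan {n : ℕ} (a : Fin n → F) (v : V) : monicOp a v ∈ diffSpan F v :=
  Submodule.add_mem _ (iterate_D_mem_diffSpan v n)
    (Submodule.sum_mem _ fun i _ => Submodule.smul_mem _ _ (iterate_D_mem_diffSpan v i))

/-- Once `Dⁿ v` depends on the lower derivatives of `v`, these already span the differential
submodule generated by `v`. -/
theorem diffSpan_le_span_of_mem {v : V} {n : ℕ}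
    (h : (D F)^[n] v ∈ Submodule.span F (Set.range fun i : Fin n => (D F)^[(i : ℕ)] v)) :
    diffSpan F v ≤ Submodule.span F (Set.range fun i : Fin n => (D F)^[(i : ℕ)] v) := by
  have hstable : ∀ w ∈ Submodule.span F (Set.range fun i : Fin n => (D F)^[(i : ℕ)] v),
      D F w ∈ Submodule.span F (Set.range fun i : Fin n => (D F)^[(i : ℕ)] v) := by
    refine fun w => D_mem_span_of_forall_mem ?_
    rintro _ ⟨i, rfl⟩
    rw [← Function.iterate_succ_apply' (D F)]
    rcases (Nat.succ_le_of_lt i.2).lt_or_eq with hi | hi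
    · exact Submodule.subset_span ⟨⟨_, hi⟩, rfl⟩
    · rwa [hi]
  refine Submodule.span_le.mpr ?_
  rintro _ ⟨i, rfl⟩
  induction i with
  | zero =>
    rcases Nat.eq_zero_or_pos n with rfl | hn
    · exact h
    · exact Submodule.subset_span ⟨⟨0, hn⟩, rfl⟩
  | succ i ih =>
    simp only [Function.iterate_succ_apply']
    exact hstable _ ih

variable [FiniteDimensional F V]

theorem exists_iterate_D_mem_span (v : V) :
    ∃ n : ℕ, (D F)^[n] v ∈ Submodule.span F (Set.range fun i : Fin n => (D F)^[(i : ℕ)] v) := by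
  obtain ⟨n, a, h⟩ := (satisfiesLinearODE_iff F v).mpr
    ⟨⊤, Module.Finite.fg_top, fun _ _ => trivial, trivial⟩
  refine ⟨n, ?_⟩
  rw [eq_neg_of_add_eq_zero_left h]
  exact Submodule.neg_mem _ (Submodule.sum_mem _ fun i _ =>
    Submodule.smul_mem _ _ (Submodule.subset_span ⟨i, rfl⟩))

/-- For finite-dimensional `V`, cyclicity in the sense of values of monic operators agrees with
generation as a differential module: a monic relation satisfied by `v` can be added to any linear
expression in the derivatives of `v`. -/
theorem isCyclicVector_iff_span (v : V) : IsCyclicVector F v ↔ diffSpan F v = ⊤ := by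
  constructor
  · intro h
    refine Submodule.eq_top_iff'.mpr fun w => ?_
    obtain ⟨n, a, rfl⟩ : w ∈ {w : V | ∃ (n : ℕ) (a : Fin n → F), w = monicOp a v} :=
      h ▸ Set.mem_univ w
    exact monicOp_mem_diffSpan a v
  · intro h
    obtain ⟨n, hn⟩ := exists_iterate_D_mem_span (F := F) v
    refine Set.eq_univ_of_forall fun w => ?_
    have hw : w - (D F)^[n] v ∈
        Submodule.span F (Set.range fun i : Fin n => (D F)^[(i : ℕ)] v) :=
      diffSpan_le_span_of_mem hn (h ▸ Submodule.mem_top)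
    obtain ⟨c, hc⟩ := (Submodule.mem_span_range_iff_exists_fun F).mp hw
    exact ⟨n, c, by rw [monicOp, hc, add_sub_cancel]⟩

/-- A generator of a finite-dimensional differential module has an initial segment of derivatives
that is a basis. -/
theorem exists_basis_iterate_D {v : V} (h : diffSpan F v = ⊤) :
    ∃ (n : ℕ) (b : Module.Basis (Fin n) F V), ∀ i, b i = (D F)^[(i : ℕ)] v := by
  classical
  have hex := exists_iterate_D_mem_span (F := F) v
  -- The length is the least order of a monic equation satisfied by `v`.
  have hli : ∀ k ≤ Nat.find hex,
      LinearIndependent F fun i : Fin k => (D F)^[(i : ℕ)] v := by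
    intro k
    induction k with
    | zero => exact fun _ => linearIndependent_empty_type
    | succ k ih =>
      intro hk
      exact linearIndependent_finSucc'.mpr ⟨ih (Nat.le_of_succ_le hk), Nat.find_min hex hk⟩
  refine ⟨Nat.find hex, Module.Basis.mk (hli _ le_rfl) ?_, fun i => Module.Basis.mk_apply _ _ i⟩
  exact h ▸ diffSpan_le_span_of_mem (Nat.find_spec hex)

end Span

/-! ### Differential homomorphisms -/

section Hom

variable {F V W : Type*} [Field F] [Differential F] [AddCommGroup V] [Module F V]
  [DifferentialModule F V] [AddCommGroup W] [Module F W] [DifferentialModule F W]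

/-- A differential homomorphism vanishing at `v` vanishes on the differential submodule generated
by `v`. -/
theorem apply_eq_zero_of_mem_diffSpan {f : V →ₗ[F] W} (hf : f ∈ diffHom F V W) {v w : V}
    (hv : f v = 0) (hw : w ∈ diffSpan F v) : f w = 0 := by
  suffices diffSpan F v ≤ LinearMap.ker f from this hw
  refine Submodule.span_le.mpr ?_
  rintro _ ⟨i, rfl⟩
  change f ((D F)^[i] v) = 0
  induction i with
  | zero => exact hv
  | succ i ih => rw [Function.iterate_succ_apply', hf, ih, map_zero]

/-- If the derivatives `Dⁱ u`, `i < n`, form a basis of `V`, then `u` satisfies a monic equation of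
order `n`, and every solution of it in a differential module is the image of `u` under a
differential homomorphism. -/
theorem exists_monicOp_forall_exists_diffHom {u : V} {n : ℕ} (b : Module.Basis (Fin n) F V)
    (hb : ∀ i, b i = (D F)^[(i : ℕ)] u) :
    ∃ a : Fin n → F, monicOp a u = 0 ∧
      ∀ y : W, monicOp a y = 0 → ∃ f ∈ diffHom F V W, f u = y := by
  have hu : monicOp (fun i => -b.repr ((D F)^[n] u) i) u = 0 := by
    have h := b.sum_repr ((D F)^[n] u)
    simp only [hb] at h
    simp [monicOp, h]
  refine ⟨_, hu, fun y hy => ?_⟩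
  let f : V →ₗ[F] W := b.constr F fun i => (D F)^[(i : ℕ)] y
  have hlt : ∀ i : Fin n, f ((D F)^[(i : ℕ)] u) = (D F)^[(i : ℕ)] y := fun i => by
    rw [← hb i]
    exact b.constr_basis F _ i
  have hle : ∀ i ≤ n, f ((D F)^[i] u) = (D F)^[i] y := by
    intro i hi
    rcases hi.lt_or_eq with hi | rfl
    · exact hlt ⟨i, hi⟩
    · rw [eq_neg_of_add_eq_zero_left hu, eq_neg_of_add_eq_zero_left hy]
      simp only [map_neg, map_sum, map_smul, hlt]
  refine ⟨f, fun w => ?_, hle 0 (Nat.zero_le n)⟩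
  induction b.mem_span w using Submodule.span_induction with
  | mem x hx =>
    obtain ⟨i, rfl⟩ := hx
    rw [hb, hlt, ← Function.iterate_succ_apply' (D F), ← Function.iterate_succ_apply' (D F)]
    exact hle _ i.2
  | zero => simp
  | add x y _ _ hx hy => simp only [map_add, hx, hy]
  | smul c x _ hx => simp only [D_smul, map_add, map_smul, hx]

/-- The quotient of a differential module by a `D`-stable subspace. It is not an instance, as it
depends on the proof of stability. -/
@[reducible]
def quotientDifferentialModule (N : Submodule F V) (hN : ∀ w ∈ N, D F w ∈ N) :
    DifferentialModule F (V ⧸ N) where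
  D := QuotientAddGroup.map N.toAddSubgroup N.toAddSubgroup (D F) hN
  D_smul a x := by
    obtain ⟨v, rfl⟩ := N.mkQ_surjective x
    change N.mkQ (D F (a • v)) = a′ • N.mkQ v + a • N.mkQ (D F v)
    rw [D_smul, map_add, map_smul, map_smul]

/-- A nonzero differential homomorphism on a quotient yields one on the module itself that is
nonzero and kills the submodule. -/
theorem exists_diffHom_of_quotient (N : Submodule F V) (hN : ∀ w ∈ N, D F w ∈ N)
    (h : letI := quotientDifferentialModule N hN; ∃ f ∈ diffHom F (V ⧸ N) W, f ≠ 0) :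
    ∃ f ∈ diffHom F V W, f ≠ 0 ∧ ∀ w ∈ N, f w = 0 := by
  let := quotientDifferentialModule N hN
  obtain ⟨f, hf, hf0⟩ := h
  refine ⟨f ∘ₗ N.mkQ, fun v => hf (N.mkQ v), fun h0 => hf0 ?_, fun w hw => ?_⟩
  · exact LinearMap.cancel_right N.mkQ_surjective |>.mp (h0.trans (LinearMap.zero_comp _).symm)
  · simp [(Submodule.Quotient.mk_eq_zero N).mpr hw]

end Hom

/-! ### Homomorphisms to the Picard–Vessiot ring -/

section PicardVessiot

variable {F E : Type*} [Field F] [Differential F] [Field E] [Differential E] [Algebra F E]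
  [DifferentialAlgebra F E]

theorem coe_iterate_D_picardVessiotRing (r : picardVessiotRing F E) (i : ℕ) :
    (((D F)^[i] r : picardVessiotRing F E) : E) = (D F)^[i] (r : E) := by
  induction i with
  | zero => rfl
  | succ i ih =>
    rw [Function.iterate_succ_apply', Function.iterate_succ_apply', ← ih]
    rfl

theorem coe_monicOp_picardVessiotRing {n : ℕ} (a : Fin n → F) (r : picardVessiotRing F E) :
    ((monicOp a r : picardVessiotRing F E) : E) = monicOp a (r : E) := by
  simp [monicOp, coe_iterate_D_picardVessiotRing]

theorem IsPicardVessiotClosure.exists_monicOp_eq_zero (hE : IsPicardVessiotClosure F E) {n : ℕ}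
    (hn : 0 < n) (a : Fin n → F) : ∃ r : picardVessiotRing F E, r ≠ 0 ∧ monicOp a r = 0 := by
  obtain ⟨y, hy, hay⟩ := hE.full_solutions n a
  refine ⟨⟨y ⟨0, hn⟩, n, a, hay _⟩, fun h => hy.ne_zero ⟨0, hn⟩ (congrArg Subtype.val h), ?_⟩
  exact Subtype.ext ((coe_monicOp_picardVessiotRing a _).trans (hay _))

/-- Every nonzero finite-dimensional differential module has a nonzero differential homomorphism
to the Picard–Vessiot ring. -/
theorem exists_diffHom_ne_zero (hE : IsPicardVessiotClosure F E) (V : Type*) [AddCommGroup V]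
    [Module F V] [DifferentialModule F V] [FiniteDimensional F V] [Nontrivial V] :
    ∃ f ∈ diffHom F V (picardVessiotRing F E), f ≠ 0 := by
  induction hd : Module.finrank F V using Nat.strong_induction_on generalizing V with
  | _ d ih =>
    obtain ⟨u, hu⟩ := exists_ne (0 : V)
    by_cases htop : diffSpan F u = ⊤
    · obtain ⟨n, b, hb⟩ := exists_basis_iterate_D htop
      have hn : 0 < n := by
        have := b.index_nonempty
        exact Fin.pos_iff_nonempty.mpr this
      obtain ⟨a, -, hlift⟩ :=
        exists_monicOp_forall_exists_diffHom (W := picardVessiotRing F E) b hb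
      obtain ⟨r, hr, har⟩ := hE.exists_monicOp_eq_zero hn a
      obtain ⟨f, hf, hfu⟩ := hlift r har
      exact ⟨f, hf, fun h0 => hr (by rw [← hfu, h0, LinearMap.zero_apply])⟩
    · -- The quotient by the submodule generated by `u` is nonzero and of smaller dimension.
      have hN : ∀ w ∈ diffSpan F u, D F w ∈ diffSpan F u := fun _ => D_mem_diffSpan
      let := quotientDifferentialModule (diffSpan F u) hN
      have : Nontrivial (V ⧸ diffSpan F u) := Submodule.Quotient.nontrivial_iff.mpr htop
      have : Nontrivial (diffSpan F u) :=
        ⟨⟨u, self_mem_diffSpan u⟩, 0, fun h => hu (congrArg Subtype.val h)⟩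
      have hpos : 0 < Module.finrank F (diffSpan F u) := Module.finrank_pos
      have hsum := (diffSpan F u).finrank_quotient_add_finrank
      obtain ⟨f, hf, hf0, -⟩ := exists_diffHom_of_quotient (diffSpan F u) hN
        (ih _ (by omega) (V ⧸ diffSpan F u) rfl)
      exact ⟨f, hf, hf0⟩

end PicardVessiot

end CyclicVector

open CyclicVector in
theorem mainTheorem1 {F E V : Type*}
    [Field F] [Differential F] [CharZero F] [IsAlgClosed (constants F)]
    [Field E] [Differential E] [Algebra F E] [DifferentialAlgebra F E]
    (hE : IsPicardVessiotClosure F E)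
    [AddCommGroup V] [Module F V] [DifferentialModule F V] [FiniteDimensional F V] :
    (∀ φ : (homRep F E V).IntertwiningMap (ringRep F E), Function.Injective φ →
      ∀ v : V, hat F E v = φ → IsCyclicVector F v) ∧
    (∀ v : V, IsCyclicVector F v → Function.Injective (hat F E v)) := by
  constructor
  · rintro _ hinj v rfl
    rw [isCyclicVector_iff_span]
    by_contra htop
    have hN : ∀ w ∈ diffSpan F v, DifferentialModule.D F w ∈ diffSpan F v :=
      fun _ => D_mem_diffSpan
    let := quotientDifferentialModule (diffSpan F v) hN
    have : Nontrivial (V ⧸ diffSpan F v) := Submodule.Quotient.nontrivial_iff.mpr htop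
    obtain ⟨f, hf, hf0, hker⟩ := exists_diffHom_of_quotient (diffSpan F v) hN
      (exists_diffHom_ne_zero hE (V ⧸ diffSpan F v))
    have h : (⟨f, hf⟩ : diffHom F V (picardVessiotRing F E)) = 0 :=
      hinj (hker v (self_mem_diffSpan v))
    exact hf0 (congrArg Subtype.val h)
  · intro v hv f g hfg
    rw [isCyclicVector_iff_span] at hv
    have hv0 : (f - g).1 v = 0 := sub_eq_zero.mpr hfg
    refine sub_eq_zero.mp (Subtype.ext (LinearMap.ext fun w => ?_))
    exact apply_eq_zero_of_mem_diffSpan (f - g).2 hv0 (hv ▸ Submodule.mem_top)
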